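/- Let $0\le n<m$ be integers and let $\lambda_1>\lambda_2>\cdots>\lambda_m>0$ be real numbers. Put $\Lambda=\operatorname{diag}(\lambda)$ and let $V=(\mathbf 1\;\;\Lambda\mathbf 1\;\cdots\;\Lambda^{n-1}\mathbf 1)$ be the $m\times n$ Vandermonde matrix of $\lambda$. For a response vector $y\in\mathbb R^m$ with at least $n$ nonzero entries let $\Psi=\operatorname{diag}(y_1^2,\dots,y_m^2)$ and let $$\omega=\omega(y)=\Lambda V\,(V^T\Psi\Lambda V)^{-1}V^T\Psi\,\mathbf 1\in\mathbb R^m$$ be the vector of shrinkage factors of the partial least squares regression with $n$ directions. For $x\in\mathbb R^m$ without zero entries, $v(x)$ is the number of indices $i\in\{1,\dots,m-1\}$ with $x_ix_{i+1}<0$. A vector $x\in\mathbb R^m$ (possibly with zero entries) is said to have exactly $n$ sign changes if both the minimum and the maximum of $v(w)$, over all $w\in\mathbb R^m$ without zero entries such that $x_iw_i\ge 0$ for all $i$, are equal to $n$; if $x$ has no zero entries this just says $v(x)=n$. The signature of $x$ is $\operatorname{sign}(x)\in\{-1,0,1\}^m$, taken entrywise. (a) If $y$ has at least $n+1$ nonzero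 entries, then $\omega_m<1$ and $\omega-\mathbf 1$ has exactly $n$ sign changes. (b) Conversely, for every signature $s\in\{-1,0,1\}^m$ (in particular for every $s\in\{-1,1\}^m$) that has exactly $n$ sign changes and $s_m=-1$, there is a $y\in\mathbb R^m$ with at least $n+1$ nonzero entries such that $\operatorname{sign}(\omega(y)-\mathbf 1)=s$. (c) The set of the signatures $\operatorname{sign}(\omega(y)-\mathbf 1)$, where $y$ ranges over all vectors in $\mathbb R^m$ with at least $n$ nonzero entries, depends only on $m$ and $n$, and not on $\lambda_1,\dots,\lambda_m$. -/

import Mathlib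

namespace PLS

open Matrix

/-- Number of nonzero entries of a vector. -/
noncomputable def cardinality {m : ℕ} (x : Fin m → ℝ) : ℕ :=
  Set.ncard {i : Fin m | x i ≠ 0}

/-- The `m × n` Vandermonde matrix with columns `1, Λ1, …, Λⁿ⁻¹1`. -/
def vandermondeMatrix {m : ℕ} (lam : Fin m → ℝ) (n : ℕ) : Matrix (Fin m) (Fin n) ℝ :=
  Matrix.of fun i k => lam i ^ (k : ℕ)

/-- The oblique projection `Q = ΛV (Vᵀ Ψ Λ V)⁻¹ Vᵀ Ψ`, with `Ψ = diag(y)²`. The inverse is a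
genuine one as soon as `y` has at least `n` nonzero entries (for distinct positive `lam`). -/
noncomputable def projectionQ {m : ℕ} (lam : Fin m → ℝ) (n : ℕ) (y : Fin m → ℝ) :
    Matrix (Fin m) (Fin m) ℝ :=
  let V := vandermondeMatrix lam n
  let L := Matrix.diagonal lam
  let Psi := Matrix.diagonal (fun i => y i ^ 2)
  L * V * (Vᵀ * Psi * L * V)⁻¹ * Vᵀ * Psi

/-- The vector of PLS shrinkages `ω = Q1`. -/
noncomputable def shrinkage {m : ℕ} (lam : Fin m → ℝ) (n : ℕ) (y : Fin m → ℝ) : Fin m → ℝ :=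
  projectionQ lam n y *ᵥ (fun _ => 1)

/-- Number of indices `i` with `x i * x (i + 1) < 0`; this is the number of sign changes of a
vector without zero entries. -/
noncomputable def signChanges {m : ℕ} (x : Fin m → ℝ) : ℕ :=
  Set.ncard {i : Fin m | ∃ h : (i : ℕ) + 1 < m, x i * x ⟨(i : ℕ) + 1, h⟩ < 0}

/-- The numbers of sign changes of the vectors without zero entries whose signs agree with
those of the nonzero entries of `x`. -/
def signChangeCounts {m : ℕ} (x : Fin m → ℝ) : Set ℕ :=
  {k | ∃ w : Fin m → ℝ, (∀ i, w i ≠ 0) ∧ (∀ i, 0 ≤ x i * w i) ∧ signChanges w = k}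

/-- Minimal number of sign changes (the zero entries are discarded). -/
noncomputable def minSignChanges {m : ℕ} (x : Fin m → ℝ) : ℕ := sInf (signChangeCounts x)

/-- Maximal number of sign changes (the zero entries get the most favourable signs). The set
is nonempty and bounded by `m`. -/
noncomputable def maxSignChanges {m : ℕ} (x : Fin m → ℝ) : ℕ := sSup (signChangeCounts x)

/-- `x` has exactly `n` sign changes, however its zero entries are treated. -/
def HasExactlySignChanges {m : ℕ} (x : Fin m → ℝ) (n : ℕ) : Prop :=
  minSignChanges x = n ∧ maxSignChanges x = n

/-- For a vector without zero entries this is the plain number of sign changes. -/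
theorem hasExactlySignChanges_iff {m : ℕ} (x : Fin m → ℝ) (hx : ∀ i, x i ≠ 0) (n : ℕ) :
    HasExactlySignChanges x n ↔ signChanges x = n := by
  have key : signChangeCounts x = {signChanges x} := by
    ext k
    constructor
    · rintro ⟨w, hw, hxw, rfl⟩
      have hpos : ∀ i, 0 < x i * w i := fun i =>
        lt_of_le_of_ne (hxw i) (mul_ne_zero (hx i) (hw i)).symm
      have hiff : ∀ i j, w i * w j < 0 ↔ x i * x j < 0 := by
        intro i j
        have h : 0 < (x i * x j) * (w i * w j) := by
          have := mul_pos (hpos i) (hpos j)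
          nlinarith
        constructor
        · intro h1
          by_contra h2
          nlinarith [mul_nonneg (not_lt.mp h2) (neg_nonneg.mpr h1.le)]
        · intro h1
          by_contra h2
          nlinarith [mul_nonneg (not_lt.mp h2) (neg_nonneg.mpr h1.le)]
      simp only [Set.mem_singleton_iff, signChanges, hiff]
    · rintro rfl
      exact ⟨x, hx, fun i => mul_self_nonneg _, rfl⟩
  simp [HasExactlySignChanges, minSignChanges, maxSignChanges, key]

/-- The signature of `ω - 1`. -/
noncomputable def shrinkagePattern {m : ℕ} (lam : Fin m → ℝ) (n : ℕ) (y : Fin m → ℝ) :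
    Fin m → SignType :=
  fun i => SignType.sign (shrinkage lam n y i - 1)

/-- All signatures of `ω - 1`, as `y` ranges over the vectors for which `ω` is well defined. -/
def possiblePatterns {m : ℕ} (lam : Fin m → ℝ) (n : ℕ) : Set (Fin m → SignType) :=
  {s | ∃ y : Fin m → ℝ, n ≤ cardinality y ∧ shrinkagePattern lam n y = s}

end PLS

/-!
The residuals `1 - ω i` are the values at `lam i` of a polynomial `r` of degree at most `n` with
`r(0) = 1`, and the normal equations say that `r` is orthogonal to all polynomials of degree less
than `n` for the measure with mass `y i ^ 2` at `lam i`. These properties characterize `r`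
(`exists_isResidual`, `IsResidual.shrinkage_eq`), so the theorem is about the signs of such
orthogonal polynomials on the points `lam i`.

Let `w` be any vector without zero entries whose signs are compatible with those of `ω - 1`.

* It has at least `n` sign changes (`le_card_signChangeSet`): a polynomial of smaller degree that
  follows the signs of `w` would not be orthogonal to `r`.
* It has at most `n` sign changes (`card_signChangeSet_le`): at the sign change positions together
  with the last index the signs of `w` alternate, and so do the coefficients of the divided
  difference, which annihilates `r` when there are more than `n` sign changes.
* As `r(0) = 1`, its last entry is negative (`eval_zero_mul_last_nonpos`), by the Lagrange
  interpolation formula for `r` at `0` on the same nodes.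

Conversely, in a signature with exactly `n` sign changes each zero lies between two opposite nonzero
entries (`exists_completion`), so there is a polynomial `r` of degree `n` with these signs
(`exists_polynomial_of_signs`). On `n + 1` points at which `r` alternates, the divided difference
of order `n` divided by `r` has coefficients of a constant sign, and these serve as the weights
`y i ^ 2` (`exists_response`).

If `y` has exactly `n` nonzero entries, `r` vanishes on the support of `y`, and its signs depend
only on that support (`shrinkagePattern_of_cardinality_eq`). Together with the description of the
case of at least `n + 1` nonzero entries, this makes the set of signatures independent of `lam`.
-/

namespace PLS

open Finset Polynomial

variable {m n : ℕ}

/-! ### Positions of sign changes -/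

open Classical in
/-- The positions `i` at which `w` changes sign between `i` and `i + 1`. -/
noncomputable def signChangeSet (w : Fin m → ℝ) : Finset (Fin m) :=
  univ.filter fun i => ∃ h : (i : ℕ) + 1 < m, w i * w ⟨(i : ℕ) + 1, h⟩ < 0

theorem mem_signChangeSet {w : Fin m → ℝ} {i : Fin m} :
    i ∈ signChangeSet w ↔ ∃ h : (i : ℕ) + 1 < m, w i * w ⟨(i : ℕ) + 1, h⟩ < 0 := by
  simp [signChangeSet]

theorem signChanges_eq_card (w : Fin m → ℝ) : signChanges w = #(signChangeSet w) := by
  rw [signChanges, ← Set.ncard_coe_finset]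
  congr 1
  ext i
  simp [mem_signChangeSet]

/-- A vector `w` without zero entries is compatible with `x` if `0 ≤ x i * w i` for all `i`. -/
theorem exists_compatible (x : Fin m → ℝ) :
    ∃ w : Fin m → ℝ, (∀ i, w i ≠ 0) ∧ ∀ i, 0 ≤ x i * w i := by
  refine ⟨fun i => if x i = 0 then 1 else x i, fun i => ?_, fun i => ?_⟩
  · by_cases h : x i = 0 <;> simp [h]
  · by_cases h : x i = 0
    · simp [h]
    · simpa [h] using mul_self_nonneg (x i)

/-- Having exactly `n` sign changes means that every admissible choice of signs for the zero
entries leads to `n` sign changes; the supremum in the definition is that of a bounded set. -/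
theorem hasExactlySignChanges_iff_forall (x : Fin m → ℝ) (n : ℕ) :
    HasExactlySignChanges x n ↔
      ∀ w : Fin m → ℝ, (∀ i, w i ≠ 0) → (∀ i, 0 ≤ x i * w i) → #(signChangeSet w) = n := by
  have hbdd : BddAbove (signChangeCounts x) := by
    refine ⟨m, ?_⟩
    rintro k ⟨w, -, -, rfl⟩
    rw [signChanges_eq_card]
    simpa using card_le_univ (signChangeSet w)
  constructor
  · rintro ⟨h1, h2⟩ w hw hxw
    have hmem : #(signChangeSet w) ∈ signChangeCounts x := ⟨w, hw, hxw, signChanges_eq_card w⟩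
    exact le_antisymm (h2 ▸ le_csSup hbdd hmem) (h1 ▸ Nat.sInf_le hmem)
  · intro h
    have key : signChangeCounts x = {n} := by
      ext k
      constructor
      · rintro ⟨w, hw, hxw, rfl⟩
        rw [signChanges_eq_card, h w hw hxw, Set.mem_singleton_iff]
      · rintro rfl
        obtain ⟨w, hw, hxw⟩ := exists_compatible x
        exact ⟨w, hw, hxw, by rw [signChanges_eq_card, h w hw hxw]⟩
    simp [HasExactlySignChanges, minSignChanges, maxSignChanges, key]

/-- The sign of `w i` relative to the last entry is the parity of the number of sign changes
at or after `i`. -/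
theorem sign_eq_neg_one_pow {w : Fin m → ℝ} (hw : ∀ i, w i ≠ 0) {l : Fin m} (hl : ∀ i, i ≤ l)
    (i : Fin m) :
    0 < w i * w l * (-1) ^ #{k ∈ signChangeSet w | i ≤ k} := by
  have hlm : (l : ℕ) + 1 = m := by
    have := l.2
    have h : m - 1 ≤ (l : ℕ) := hl ⟨m - 1, by omega⟩
    omega
  -- Induction on the distance `d` of `i` from the last index.
  obtain ⟨d, hd⟩ : ∃ d : ℕ, (i : ℕ) + d = l := ⟨l - i, by have := hl i; omega⟩
  induction d generalizing i with
  | zero =>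
    obtain rfl : i = l := Fin.ext (by omega)
    have : #{k ∈ signChangeSet w | i ≤ k} = 0 := by
      rw [card_eq_zero, filter_eq_empty_iff]
      intro k hk hik
      obtain ⟨h, -⟩ := mem_signChangeSet.mp hk
      have : (i : ℕ) ≤ k := hik
      omega
    rw [this, pow_zero, mul_one]
    exact mul_self_pos.mpr (hw i)
  | succ d ih =>
    have him : (i : ℕ) + 1 < m := by omega
    set j : Fin m := ⟨(i : ℕ) + 1, him⟩ with hj
    have hjd : (j : ℕ) + d = l := by rw [hj]; simp only; omega
    have hstep := ih j hjd
    have hle : ∀ k : Fin m, i ≤ k ↔ k = i ∨ j ≤ k := by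
      intro k
      simp only [Fin.le_def, Fin.ext_iff, hj]
      omega
    have hji : ¬ j ≤ i := by simp [Fin.le_def, hj]
    by_cases hi : i ∈ signChangeSet w
    · have hcard : #{k ∈ signChangeSet w | i ≤ k} = #{k ∈ signChangeSet w | j ≤ k} + 1 := by
        rw [← card_insert_of_notMem (a := i) (by simp [hji])]
        congr 1
        ext k
        simp only [mem_filter, mem_insert, hle]
        constructor
        · tauto
        · rintro (rfl | h)
          · exact ⟨hi, Or.inl rfl⟩
          · tauto
      obtain ⟨_, hneg⟩ := mem_signChangeSet.mp hi
      rw [hcard, pow_succ]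
      have h1 := mul_pos (neg_pos.mpr hneg) hstep
      have h2 : 0 < w j ^ 2 := by have := hw j; positivity
      refine pos_of_mul_pos_right (a := w j ^ 2) ?_ h2.le
      rw [← hj] at h1
      linarith
    · have hcard : #{k ∈ signChangeSet w | i ≤ k} = #{k ∈ signChangeSet w | j ≤ k} := by
        congr 1
        ext k
        simp only [mem_filter, hle]
        constructor
        · rintro ⟨hk, rfl | h⟩
          · exact absurd hk hi
          · exact ⟨hk, h⟩
        · tauto
      have hpos : 0 < w i * w j := by
        refine lt_of_le_of_ne ?_ (mul_ne_zero (hw i) (hw j)).symm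
        by_contra hneg
        exact hi (mem_signChangeSet.mpr ⟨him, not_le.mp hneg⟩)
      rw [hcard]
      have h1 := mul_pos hpos hstep
      have h2 : 0 < w j ^ 2 := by have := hw j; positivity
      refine pos_of_mul_pos_right (a := w j ^ 2) ?_ h2.le
      linarith

theorem last_notMem_signChangeSet (w : Fin m → ℝ) {l : Fin m} (hl : ∀ i, i ≤ l) :
    l ∉ signChangeSet w := by
  intro h
  obtain ⟨h, -⟩ := mem_signChangeSet.mp h
  have : (l : ℕ) + 1 ≤ l := hl ⟨l + 1, h⟩
  omega

theorem prod_mul_neg_one_pow_pos {ι : Type*} (s : Finset ι) (a : ι → ℝ) (p : ι → Prop)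
    [DecidablePred p] (hneg : ∀ i ∈ s, p i → a i < 0) (hpos : ∀ i ∈ s, ¬ p i → 0 < a i) :
    0 < (∏ i ∈ s, a i) * (-1) ^ #{i ∈ s | p i} := by
  have : (∏ i ∈ s, a i) * (-1) ^ #{i ∈ s | p i} = ∏ i ∈ s, a i * (if p i then -1 else 1) := by
    rw [prod_mul_distrib, prod_ite]
    simp
  rw [this]
  refine prod_pos fun i hi => ?_
  by_cases h : p i
  · simpa [h] using hneg i hi h
  · simpa [h] using hpos i hi h

/-- If every sign change `i` of `w` contributes one root `theta i`, above `lam j` for `i < j` and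
below `lam j` otherwise, then the polynomial with these roots has at `lam j` the sign of `w j`, up
to the constant factor `w l`. -/
theorem prod_sub_mul_pos {w : Fin m → ℝ} (hw : ∀ i, w i ≠ 0) {l : Fin m} (hl : ∀ i, i ≤ l)
    (lam theta : Fin m → ℝ) (j : Fin m)
    (hlt : ∀ i ∈ signChangeSet w, j ≤ i → theta i < lam j)
    (hgt : ∀ i ∈ signChangeSet w, i < j → lam j < theta i) :
    0 < (∏ i ∈ signChangeSet w, (theta i - lam j)) * (w j * w l) := by
  have h1 := prod_mul_neg_one_pow_pos (signChangeSet w) (fun i => theta i - lam j) (j ≤ ·)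
    (fun i hi h => sub_neg.mpr (hlt i hi h)) (fun i hi h => sub_pos.mpr (hgt i hi (not_le.mp h)))
  have h2 := mul_pos h1 (sign_eq_neg_one_pow hw hl j)
  have h3 : ((-1 : ℝ) ^ #{k ∈ signChangeSet w | j ≤ k}) *
      (-1) ^ #{k ∈ signChangeSet w | j ≤ k} = 1 := by
    rw [← mul_pow]; simp
  calc 0 < _ := h2
    _ = (∏ i ∈ signChangeSet w, (theta i - lam j)) * (w j * w l) *
      ((-1 : ℝ) ^ #{k ∈ signChangeSet w | j ≤ k} *
        (-1) ^ #{k ∈ signChangeSet w | j ≤ k}) := by ring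
    _ = _ := by rw [h3, mul_one]

/-- At the nodes formed by the sign change positions of `w` and the last index, the signs of `w`
alternate, just as those of the denominators in Lagrange interpolation. -/
theorem prod_erase_mul_pos {w : Fin m → ℝ} (hw : ∀ i, w i ≠ 0) {l : Fin m} (hl : ∀ i, i ≤ l)
    {lam : Fin m → ℝ} (hlam : StrictAnti lam) {i : Fin m}
    (hi : i ∈ insert l (signChangeSet w)) :
    0 < (∏ j ∈ (insert l (signChangeSet w)).erase i, (lam i - lam j)) *
      ((-1) ^ #(signChangeSet w) * w i * w l) := by
  have h1 := prod_mul_neg_one_pow_pos ((insert l (signChangeSet w)).erase i)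
    (fun j => lam i - lam j) (· < i)
    (fun j _ h => sub_neg.mpr (hlam h))
    (fun j hj h => sub_pos.mpr (hlam (lt_of_le_of_ne (not_lt.mp h) (ne_of_mem_erase hj).symm)))
  have hset : {j ∈ (insert l (signChangeSet w)).erase i | j < i} =
      {j ∈ signChangeSet w | ¬ i ≤ j} := by
    ext j
    simp only [mem_filter, mem_erase, mem_insert, not_le]
    constructor
    · rintro ⟨⟨-, rfl | h⟩, hji⟩
      · exact absurd (hl i) (not_le.mpr hji)
      · exact ⟨h, hji⟩
    · rintro ⟨h, hji⟩
      exact ⟨⟨hji.ne, Or.inr h⟩, hji⟩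
  rw [hset] at h1
  have h2 := mul_pos h1 (sign_eq_neg_one_pow hw hl i)
  rw [← card_filter_add_card_filter_not (s := signChangeSet w) (i ≤ ·), pow_add]
  calc 0 < _ := h2
    _ = _ := by ring

/-! ### The residual polynomial -/

/-- `r` is a residual polynomial of the partial least squares problem: it has degree at most `n`,
is normalized by `r(0) = 1`, and is orthogonal to all polynomials of degree less than `n` for the
discrete measure with mass `y i ^ 2` at `lam i`. -/
structure IsResidual (lam : Fin m → ℝ) (n : ℕ) (y : Fin m → ℝ) (r : ℝ[X]) : Prop where
  degree_lt : r.degree < (n + 1 : ℕ)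
  eval_zero : r.eval 0 = 1
  orthogonal : ∀ k < n, ∑ i, y i ^ 2 * lam i ^ k * r.eval (lam i) = 0

theorem cardinality_eq_card (y : Fin m → ℝ) : cardinality y = #{i | y i ≠ 0} := by
  rw [cardinality, ← Set.ncard_coe_finset]
  congr 1
  ext i
  simp

theorem sum_mul_eval_mul_eq_zero {a x : Fin m → ℝ}
    (h : ∀ k < n, ∑ i, a i * x i ^ k = 0) {q : ℝ[X]} (hq : q.degree < n) :
    ∑ i, a i * q.eval (x i) = 0 := by
  by_cases hq0 : q = 0
  · simp [hq0]
  have hdeg : q.natDegree < n := (natDegree_lt_iff_degree_lt hq0).mpr hq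
  simp_rw [eval_eq_sum_range' hdeg, mul_sum]
  rw [sum_comm]
  refine sum_eq_zero fun k hk => ?_
  have := h k (mem_range.mp hk)
  calc ∑ i, a i * (q.coeff k * x i ^ k) = q.coeff k * ∑ i, a i * x i ^ k := by
        rw [mul_sum]; exact sum_congr rfl fun i _ => by ring
    _ = 0 := by rw [this, mul_zero]

/-- A polynomial of degree less than `cardinality y` is determined by its values on the support
of `y`. -/
theorem eq_zero_of_eval_eq_zero_of_ne {lam : Fin m → ℝ} (hinj : Function.Injective lam)
    {y : Fin m → ℝ} {q : ℝ[X]} (hq : q.degree < cardinality y)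
    (h : ∀ i, y i ≠ 0 → q.eval (lam i) = 0) : q = 0 := by
  rw [cardinality_eq_card] at hq
  exact eq_zero_of_degree_lt_of_eval_index_eq_zero _ hinj.injOn hq
    fun i hi => h i (mem_filter.mp hi).2

/-- The normal equations are nonsingular: their quadratic form at `q` is
`∑ y i ^ 2 * lam i * q (lam i) ^ 2`. -/
theorem eq_zero_of_normal_equations {lam : Fin m → ℝ} (hpos : ∀ i, 0 < lam i)
    (hinj : Function.Injective lam) {y : Fin m → ℝ} (hy : n ≤ cardinality y) {q : ℝ[X]}
    (hq : q.degree < n)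
    (h : ∀ k < n, ∑ i, y i ^ 2 * lam i ^ k * (lam i * q.eval (lam i)) = 0) : q = 0 := by
  have h1 : ∑ i, y i ^ 2 * (lam i * q.eval (lam i)) * q.eval (lam i) = 0 :=
    sum_mul_eval_mul_eq_zero
      (fun k hk => by rw [← h k hk]; exact sum_congr rfl fun i _ => by ring) hq
  have h2 := (sum_eq_zero_iff_of_nonneg fun i _ => by
    have := (hpos i).le
    have : y i ^ 2 * (lam i * q.eval (lam i)) * q.eval (lam i) =
      lam i * (y i * q.eval (lam i)) ^ 2 := by ring
    rw [this]; positivity).mp h1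
  refine eq_zero_of_eval_eq_zero_of_ne hinj
    (hq.trans_le (by exact_mod_cast hy)) fun i hi => ?_
  have h3 := h2 i (mem_univ i)
  have h4 := (hpos i).ne'
  simpa [hi, h4] using h3

open Matrix in
theorem vandermondeMatrix_mulVec (lam : Fin m → ℝ) (c : Fin n → ℝ) (i : Fin m) :
    (vandermondeMatrix lam n *ᵥ c) i = (∑ k : Fin n, C (c k) * X ^ (k : ℕ)).eval (lam i) := by
  simp only [mulVec, dotProduct, vandermondeMatrix, of_apply, eval_finsetSum, eval_mul, eval_C,
    eval_pow, eval_X]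
  exact sum_congr rfl fun k _ => mul_comm _ _

open Matrix in
theorem isUnit_normal_matrix {lam : Fin m → ℝ} (hpos : ∀ i, 0 < lam i)
    (hinj : Function.Injective lam) {y : Fin m → ℝ} (hy : n ≤ cardinality y) :
    IsUnit ((vandermondeMatrix lam n)ᵀ * diagonal (fun i => y i ^ 2) * diagonal lam *
      vandermondeMatrix lam n) := by
  rw [← mulVec_injective_iff_isUnit]
  rw [← coe_mulVecLin, ← LinearMap.ker_eq_bot, LinearMap.ker_eq_bot']
  intro c hc
  set q : ℝ[X] := ∑ k : Fin n, C (c k) * X ^ (k : ℕ) with hqdef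
  have hq : q.degree < n := degree_sum_fin_lt c
  have hV : ∀ i, (vandermondeMatrix lam n *ᵥ c) i = q.eval (lam i) :=
    vandermondeMatrix_mulVec lam c
  have hq0 : q = 0 := by
    refine eq_zero_of_normal_equations hpos hinj hy hq fun k hk => ?_
    have := congrFun hc ⟨k, hk⟩
    rw [mulVecLin_apply, ← mulVec_mulVec, ← mulVec_mulVec, ← mulVec_mulVec] at this
    rw [mulVec, dotProduct, Pi.zero_apply] at this
    rw [← this]
    refine sum_congr rfl fun i _ => ?_
    rw [mulVec_diagonal, mulVec_diagonal, hV]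
    simp [vandermondeMatrix]
    ring
  ext k
  have := congrArg (fun p => p.coeff k) hq0
  simpa [hqdef, finsetSum_coeff, coeff_X_pow, Fin.val_inj] using this

open Matrix in
/-- The residuals of partial least squares are the values of a residual polynomial, namely of
`1 - X * q` where the coefficients of `q` solve the normal equations. -/
theorem exists_isResidual {lam : Fin m → ℝ} (hpos : ∀ i, 0 < lam i)
    (hinj : Function.Injective lam) {y : Fin m → ℝ} (hy : n ≤ cardinality y) :
    ∃ r, IsResidual lam n y r ∧ ∀ i, shrinkage lam n y i = 1 - r.eval (lam i) := by
  set V := vandermondeMatrix lam n with hVdef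
  set A := Vᵀ * diagonal (fun i => y i ^ 2) * diagonal lam * V with hA
  have hunit : IsUnit A := isUnit_normal_matrix hpos hinj hy
  set c : Fin n → ℝ := A⁻¹ *ᵥ (Vᵀ *ᵥ (fun i => y i ^ 2)) with hc
  set q : ℝ[X] := ∑ k : Fin n, C (c k) * X ^ (k : ℕ) with hqdef
  have hq : q.degree < n := degree_sum_fin_lt c
  have hV : ∀ i, (V *ᵥ c) i = q.eval (lam i) :=
    vandermondeMatrix_mulVec lam c
  have hshr : ∀ i, shrinkage lam n y i = lam i * q.eval (lam i) := by
    intro i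
    have : shrinkage lam n y = diagonal lam *ᵥ (V *ᵥ c) := by
      rw [shrinkage, projectionQ, hc]
      simp only [mulVec_mulVec]
      rw [← hVdef, ← hA]
      have h1 : (fun i => y i ^ 2) = diagonal (fun i => y i ^ 2) *ᵥ (fun _ => (1 : ℝ)) := by
        ext i; simp [mulVec_diagonal]
      rw [h1, mulVec_mulVec, ← h1]
      simp only [Matrix.mul_assoc]
    rw [this, mulVec_diagonal, hV]
  refine ⟨1 - X * q, ⟨?_, by simp, ?_⟩, fun i => by rw [hshr]; simp⟩
  · rw [degree_lt_iff_coeff_zero]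
    intro k hk
    obtain ⟨k, rfl⟩ : ∃ j, k = j + 1 := ⟨k - 1, by omega⟩
    rw [coeff_sub, coeff_X_mul, coeff_one]
    simp [(degree_lt_iff_coeff_zero _ _).mp hq k (by omega)]
  · intro k hk
    have h1 : A *ᵥ c = Vᵀ *ᵥ (fun i => y i ^ 2) := by
      rw [hc, mulVec_mulVec, Matrix.mul_nonsing_inv _ ((isUnit_iff_isUnit_det _).mp hunit),
        one_mulVec]
    have h2 := congrFun h1 ⟨k, hk⟩
    rw [hA, ← mulVec_mulVec, ← mulVec_mulVec, ← mulVec_mulVec, mulVec, mulVec, dotProduct,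
      dotProduct] at h2
    simp only [mulVec_diagonal, hV] at h2
    rw [eq_comm, ← sub_eq_zero, ← sum_sub_distrib] at h2
    rw [← h2]
    refine sum_congr rfl fun i _ => ?_
    simp [hVdef, vandermondeMatrix]
    ring

/-- The residual polynomial is unique, so that it determines the shrinkage factors. -/
theorem IsResidual.shrinkage_eq {lam : Fin m → ℝ} (hpos : ∀ i, 0 < lam i)
    (hinj : Function.Injective lam) {y : Fin m → ℝ} (hy : n ≤ cardinality y) {r : ℝ[X]}
    (hr : IsResidual lam n y r) (i : Fin m) :
    shrinkage lam n y i = 1 - r.eval (lam i) := by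
  obtain ⟨s, hs, hshr⟩ := exists_isResidual hpos hinj hy
  have h0 : (s - r).coeff 0 = 0 := by
    rw [coeff_zero_eq_eval_zero, eval_sub, hs.eval_zero, hr.eval_zero, sub_self]
  obtain ⟨q, hq⟩ := X_dvd_iff.mpr h0
  have hdeg : (s - r).degree < (n + 1 : ℕ) :=
    (degree_sub_le _ _).trans_lt (max_lt hs.degree_lt hr.degree_lt)
  have hq0 : q = 0 := by
    refine eq_zero_of_normal_equations hpos hinj hy ?_ fun k hk => ?_
    · rw [degree_lt_iff_coeff_zero] at hdeg ⊢
      intro k hk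
      rw [← coeff_X_mul, ← hq]
      exact hdeg _ (by omega)
    · have h1 := hs.orthogonal k hk
      have h2 := hr.orthogonal k hk
      rw [← sub_eq_zero.mpr (h1.trans h2.symm), ← sum_sub_distrib]
      refine sum_congr rfl fun i _ => ?_
      have h3 := congrArg (eval (lam i)) hq
      rw [eval_sub, eval_mul, eval_X] at h3
      rw [← h3]; ring
  rw [hshr, sub_eq_zero.mp (hq.trans (by rw [hq0, mul_zero]))]

/-! ### Sign changes of the residual polynomial -/

theorem card_insert_last (w : Fin m → ℝ) {l : Fin m} (hl : ∀ i, i ≤ l) :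
    #(insert l (signChangeSet w)) = #(signChangeSet w) + 1 :=
  card_insert_of_notMem (last_notMem_signChangeSet w hl)

theorem div_mul_nonpos_of_mul_pos {a d t w v : ℝ} (h1 : a * w ≤ 0) (h2 : 0 < d * (t * w * v)) :
    a / d * (t * v) ≤ 0 := by
  have hd : d ≠ 0 := left_ne_zero_of_mul h2.ne'
  have h4 : a / d * (t * v) = a * w * (t * v) ^ 2 / (d * (t * w * v)) := by
    rw [div_mul_eq_mul_div, div_eq_div_iff hd h2.ne']
    ring
  rw [h4]
  exact div_nonpos_of_nonpos_of_nonneg (mul_nonpos_of_nonpos_of_nonneg h1 (sq_nonneg _)) h2.le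

/-- The midpoint of `lam i` and `lam (i + 1)`; the value at the last index is immaterial. -/
noncomputable def gapMidpoint (lam : Fin m → ℝ) (i : Fin m) : ℝ :=
  if h : (i : ℕ) + 1 < m then (lam i + lam ⟨i + 1, h⟩) / 2 else 0

theorem gapMidpoint_bounds {lam : Fin m → ℝ} (hlam : StrictAnti lam) {i : Fin m}
    (h : (i : ℕ) + 1 < m) :
    lam ⟨i + 1, h⟩ < gapMidpoint lam i ∧ gapMidpoint lam i < lam i := by
  have : lam ⟨i + 1, h⟩ < lam i := hlam (by simp [Fin.lt_def])
  rw [gapMidpoint, dif_pos h]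
  constructor <;> linarith

theorem degree_prod_C_sub_X (s : Finset (Fin m)) (theta : Fin m → ℝ) :
    (∏ i ∈ s, (C (theta i) - X)).degree = (#s : WithBot ℕ) := by
  rw [degree_prod, sum_congr rfl (g := fun _ => (1 : WithBot ℕ)), sum_const, nsmul_one]
  intro i _
  rw [← neg_sub, degree_neg, degree_X_sub_C]

/-- If `r` is orthogonal to the polynomials of degree less than `n`, then its values have at
least `n` sign changes: otherwise a polynomial of degree less than `n` would have the same signs. -/
theorem le_card_signChangeSet {lam : Fin m → ℝ} (hlam : StrictAnti lam) {y : Fin m → ℝ}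
    (hy : n < cardinality y) {r : ℝ[X]} (hr : IsResidual lam n y r) {l : Fin m}
    (hl : ∀ i, i ≤ l) {w : Fin m → ℝ} (hw : ∀ i, w i ≠ 0)
    (hrw : ∀ i, r.eval (lam i) * w i ≤ 0) : n ≤ #(signChangeSet w) := by
  by_contra! hlt
  set p : ℝ[X] := ∏ i ∈ signChangeSet w, (C (gapMidpoint lam i) - X) with hp
  have hpdeg : p.degree < n := by
    rw [hp, degree_prod_C_sub_X]
    exact_mod_cast hlt
  have hpw : ∀ j, 0 < p.eval (lam j) * (w j * w l) := by
    intro j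
    have := prod_sub_mul_pos hw hl lam (gapMidpoint lam) j
      (fun i hi hji => by
        obtain ⟨h, -⟩ := mem_signChangeSet.mp hi
        exact (gapMidpoint_bounds hlam h).2.trans_le (hlam.antitone hji))
      (fun i hi hij => by
        obtain ⟨h, -⟩ := mem_signChangeSet.mp hi
        exact (hlam.antitone (show (⟨i + 1, h⟩ : Fin m) ≤ j from hij)).trans_lt
          (gapMidpoint_bounds hlam h).1)
    simpa [hp, eval_prod] using this
  have hsum : ∑ i, y i ^ 2 * r.eval (lam i) * p.eval (lam i) = 0 :=
    sum_mul_eval_mul_eq_zero (fun k hk => by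
      rw [← hr.orthogonal k hk]; exact sum_congr rfl fun i _ => by ring) hpdeg
  -- Dividing by `w i ^ 2` turns the orthogonality relation, multiplied by `-w l`, into a sum of
  -- products of the sign conditions `hrw` and `hpw`, hence of nonnegative terms.
  have hsum' : ∑ i, y i ^ 2 * (-(r.eval (lam i) * w i) *
      (p.eval (lam i) * (w i * w l)) / w i ^ 2) = 0 := by
    rw [← mul_zero (-w l), ← hsum, mul_sum]
    refine sum_congr rfl fun i _ => ?_
    have := hw i
    field_simp
  have hzero := (sum_eq_zero_iff_of_nonneg fun i _ => mul_nonneg (sq_nonneg _)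
    (div_nonneg (mul_nonneg (neg_nonneg.mpr (hrw i)) (hpw i).le) (sq_nonneg _))).mp hsum'
  have hr0 : r = 0 := by
    refine eq_zero_of_eval_eq_zero_of_ne hlam.injective
      (hr.degree_lt.trans_le (by exact_mod_cast hy)) fun i hi => ?_
    have h1 := hzero i (mem_univ i)
    have h2 := (hpw i).ne'
    simp only [mul_eq_zero, div_eq_zero_iff, neg_eq_zero, pow_eq_zero_iff, ne_eq,
      OfNat.ofNat_ne_zero, not_false_eq_true, hi, hw i, false_or, or_false] at h1 h2
    tauto
  have := hr.eval_zero
  simp [hr0] at this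

/-- The values of a nonzero polynomial of degree at most `n` have at most `n` sign changes:
otherwise all terms of a vanishing divided difference would have the same sign. -/
theorem card_signChangeSet_le {lam : Fin m → ℝ} (hlam : StrictAnti lam) {r : ℝ[X]}
    (hdeg : r.degree < (n + 1 : ℕ)) (hr0 : r ≠ 0) {l : Fin m} (hl : ∀ i, i ≤ l)
    {w : Fin m → ℝ} (hw : ∀ i, w i ≠ 0)
    (hrw : ∀ i, r.eval (lam i) * w i ≤ 0) : #(signChangeSet w) ≤ n := by
  by_contra! hlt
  have hcard := card_insert_last w hl
  have hdeg' : r.degree < #(insert l (signChangeSet w)) :=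
    hdeg.trans_le (by rw [hcard]; exact_mod_cast (by omega))
  have h1 := Lagrange.coeff_eq_sum hlam.injective.injOn hdeg'
  rw [hcard, Nat.add_sub_cancel, (degree_lt_iff_coeff_zero _ _).mp hdeg _ hlt] at h1
  have h2 : ∑ i ∈ insert l (signChangeSet w), r.eval (lam i) /
      (∏ j ∈ (insert l (signChangeSet w)).erase i, (lam i - lam j)) *
        ((-1) ^ #(signChangeSet w) * w l) = 0 := by
    rw [← sum_mul, ← h1, zero_mul]
  have h3 := (sum_eq_zero_iff_of_nonpos fun i hi =>
    div_mul_nonpos_of_mul_pos (hrw i) (prod_erase_mul_pos hw hl hlam hi)).mp h2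
  refine hr0 (eq_zero_of_degree_lt_of_eval_index_eq_zero _ hlam.injective.injOn hdeg'
    fun i hi => ?_)
  have h4 := (prod_erase_mul_pos hw hl hlam hi).ne'
  have h5 := h3 i hi
  have h6 : (-1 : ℝ) ^ #(signChangeSet w) ≠ 0 := by positivity
  rw [mul_eq_zero, div_eq_zero_iff] at h5
  rcases h5 with (h5 | h5) | h5
  · exact h5
  · exact absurd h5 (left_ne_zero_of_mul h4)
  · exact absurd h5 (mul_ne_zero h6 (hw l))

/-- If the values of `r` at the points `lam i` realize `n` sign changes, then there is no further
sign change between the smallest point and `0`. This is read off from the Lagrange interpolation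
formula at `0`, whose terms all have the same sign. -/
theorem eval_zero_mul_last_nonpos {lam : Fin m → ℝ} (hpos : ∀ i, 0 < lam i)
    (hlam : StrictAnti lam) {r : ℝ[X]}
    (hdeg : r.degree < (n + 1 : ℕ)) {l : Fin m} (hl : ∀ i, i ≤ l)
    {w : Fin m → ℝ} (hw : ∀ i, w i ≠ 0) (hrw : ∀ i, r.eval (lam i) * w i ≤ 0)
    (hn : n ≤ #(signChangeSet w)) : r.eval 0 * w l ≤ 0 := by
  have hcard := card_insert_last w hl
  have hdeg' : r.degree < #(insert l (signChangeSet w)) :=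
    hdeg.trans_le (by rw [hcard]; exact_mod_cast (by omega))
  rw [Lagrange.eq_interpolate hlam.injective.injOn hdeg', Lagrange.interpolate_eq_sum,
    eval_finsetSum, sum_mul]
  refine sum_nonpos fun i hi => ?_
  have h1 := div_mul_nonpos_of_mul_pos (hrw i) (prod_erase_mul_pos hw hl hlam hi)
  have h2 : (∏ j ∈ (insert l (signChangeSet w)).erase i, (0 - lam j)) =
      (-1) ^ #(signChangeSet w) * ∏ j ∈ (insert l (signChangeSet w)).erase i, lam j := by
    simp only [zero_sub]
    rw [prod_neg, card_erase_of_mem hi, hcard, Nat.add_sub_cancel]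
  have h3 : 0 < ∏ j ∈ (insert l (signChangeSet w)).erase i, lam j := prod_pos fun j _ => hpos j
  simp only [eval_mul, eval_C, eval_prod, eval_sub, eval_X]
  rw [h2]
  calc _ = _ := by ring
    _ ≤ 0 := mul_nonpos_of_nonpos_of_nonneg h1 h3.le

/-- The direct statement on the signature: `ω - 1` has exactly `n` sign changes and ends with a
negative entry. -/
theorem shrinkage_sub_one_signs {lam : Fin m → ℝ} (hpos : ∀ i, 0 < lam i)
    (hlam : StrictAnti lam) {y : Fin m → ℝ} (hy : n < cardinality y) {l : Fin m}
    (hl : ∀ i, i ≤ l) :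
    shrinkage lam n y l < 1 ∧ HasExactlySignChanges (fun i => shrinkage lam n y i - 1) n := by
  obtain ⟨r, hr, hshr⟩ := exists_isResidual hpos hlam.injective hy.le
  have hr0 : r ≠ 0 := by
    rintro rfl
    simpa using hr.eval_zero
  have hx : ∀ i, shrinkage lam n y i - 1 = -r.eval (lam i) := fun i => by rw [hshr]; ring
  constructor
  · by_contra! hge
    have hrl : r.eval (lam l) ≤ 0 := by have := hx l; linarith
    -- A compatible vector with last entry `1` contradicts `eval_zero_mul_last_nonpos`.
    obtain ⟨w, hw, hrw⟩ := exists_compatible fun i => -r.eval (lam i)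
    have hw' : ∀ i, Function.update w l 1 i ≠ 0 := by
      intro i
      rcases eq_or_ne i l with rfl | h
      · simp
      · simpa [h] using hw i
    have hrw' : ∀ i, r.eval (lam i) * Function.update w l 1 i ≤ 0 := by
      intro i
      rcases eq_or_ne i l with rfl | h
      · simpa using hrl
      · simpa [h] using hrw i
    have := eval_zero_mul_last_nonpos hpos hlam hr.degree_lt hl hw' hrw'
      (le_card_signChangeSet hlam hy hr hl hw' hrw')
    rw [hr.eval_zero] at this
    simp only [Function.update_self] at this
    linarith
  · rw [hasExactlySignChanges_iff_forall]
    intro w hw hxw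
    have hrw : ∀ i, r.eval (lam i) * w i ≤ 0 := fun i => by
      have := hxw i
      rw [hx] at this
      linarith
    exact le_antisymm (card_signChangeSet_le hlam hr.degree_lt hr0 hl hw hrw)
      (le_card_signChangeSet hlam hy hr hl hw hrw)

/-! ### Zero entries of a signature -/

/-- Flipping an entry that is opposite to its neighbours removes sign changes. -/
theorem card_signChangeSet_update_neg_lt {w : Fin m → ℝ} {i : Fin m} (hi : (i : ℕ) + 1 < m)
    (hprev : ∀ k : Fin m, (k : ℕ) + 1 = i → w k * w i < 0) (hnext : w i * w ⟨i + 1, hi⟩ < 0) :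
    #(signChangeSet (Function.update w i (-w i))) < #(signChangeSet w) := by
  have hne : (⟨i + 1, hi⟩ : Fin m) ≠ i := by simp [Fin.ext_iff]
  refine card_lt_card (ssubset_iff_of_subset ?_ |>.mpr ⟨i, ?_, ?_⟩)
  · intro k hk
    obtain ⟨h, hlt⟩ := mem_signChangeSet.mp hk
    refine mem_signChangeSet.mpr ⟨h, ?_⟩
    have hki : k ≠ i := by
      rintro rfl
      rw [Function.update_self, Function.update_of_ne hne] at hlt
      linarith
    have hki' : (⟨k + 1, h⟩ : Fin m) ≠ i := by
      intro heq
      rw [heq, Function.update_self, Function.update_of_ne hki] at hlt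
      have := hprev k (by rw [← heq])
      linarith
    rwa [Function.update_of_ne hki, Function.update_of_ne hki'] at hlt
  · exact mem_signChangeSet.mpr ⟨hi, hnext⟩
  · intro h
    obtain ⟨h, hlt⟩ := mem_signChangeSet.mp h
    rw [Function.update_self, Function.update_of_ne hne] at hlt
    linarith

theorem compatible_update {x w : Fin m → ℝ} (hw : ∀ i, w i ≠ 0) (hxw : ∀ i, 0 ≤ x i * w i)
    {i : Fin m} (hx : x i = 0) {a : ℝ} (ha : a ≠ 0) :
    (∀ k, Function.update w i a k ≠ 0) ∧ ∀ k, 0 ≤ x k * Function.update w i a k := by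
  refine ⟨fun k => ?_, fun k => ?_⟩ <;> rcases eq_or_ne k i with rfl | h
  · simpa using ha
  · simpa [h] using hw k
  · simp [hx]
  · simpa [h] using hxw k

/-- If a zero entry takes the sign of its successor, then it has a predecessor of the opposite
sign: otherwise giving it the other sign would create sign changes. -/
theorem exists_prev_of_zero {x w : Fin m → ℝ} (hx : HasExactlySignChanges x n)
    (hw : ∀ i, w i ≠ 0) (hxw : ∀ i, 0 ≤ x i * w i) {i : Fin m} (hxi : x i = 0)
    (hi : (i : ℕ) + 1 < m) (hnext : 0 < w i * w ⟨i + 1, hi⟩) :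
    ∃ k : Fin m, (k : ℕ) + 1 = i ∧ w k * w i < 0 := by
  rw [hasExactlySignChanges_iff_forall] at hx
  by_contra! hcon
  have hne : (⟨i + 1, hi⟩ : Fin m) ≠ i := by simp [Fin.ext_iff]
  obtain ⟨hw1, hxw1⟩ := compatible_update hw hxw hxi (neg_ne_zero.mpr (hw i))
  obtain ⟨hw2, hxw2⟩ := compatible_update hw1 hxw1 hxi (neg_ne_zero.mpr (hw1 i))
  have := card_signChangeSet_update_neg_lt (w := Function.update w i (-w i)) hi
    (fun k hk => by
      have hki : k ≠ i := by rintro rfl; omega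
      rw [Function.update_self, Function.update_of_ne hki]
      have h1 := lt_of_le_of_ne (hcon k hk) (mul_ne_zero (hw k) (hw i)).symm
      linarith)
    (by rw [Function.update_self, Function.update_of_ne hne]; linarith)
  rw [hx _ hw1 hxw1, hx _ hw2 hxw2] at this
  exact lt_irrefl _ this

/-- No two consecutive entries vanish: the entry after a zero could take either sign, and with one
of them the zero entry would have to change the number of sign changes when flipped. -/
theorem succ_ne_zero_of_zero {x : Fin m → ℝ} (hx : HasExactlySignChanges x n) {i : Fin m}
    (hxi : x i = 0) (hi : (i : ℕ) + 1 < m) : x ⟨i + 1, hi⟩ ≠ 0 := by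
  intro hxj
  set j : Fin m := ⟨i + 1, hi⟩ with hj
  have hij : i ≠ j := by simp [hj, Fin.ext_iff]
  obtain ⟨v, hv, hxv⟩ := exists_compatible x
  -- Let both zeros take the same sign, so that the sign change is before `i`; flipping the entry
  -- at `j` then makes the entry at `i` opposite to both of its neighbours.
  obtain ⟨hw1, hxw1⟩ := compatible_update hv hxv hxj (hv i)
  set w := Function.update v j (v i) with hwdef
  have hwi : w i = v i := by rw [hwdef, Function.update_of_ne hij]
  have hwj : w j = v i := by rw [hwdef, Function.update_self]
  obtain ⟨k, hk, hki⟩ := exists_prev_of_zero hx hw1 hxw1 hxi hi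
    (by rw [← hj, hwi, hwj]; exact mul_self_pos.mpr (hv i))
  obtain ⟨hw2, hxw2⟩ := compatible_update hw1 hxw1 hxj (neg_ne_zero.mpr (hw1 j))
  obtain ⟨hw3, hxw3⟩ := compatible_update hw2 hxw2 hxi (neg_ne_zero.mpr (hw2 i))
  have := card_signChangeSet_update_neg_lt (w := Function.update w j (-w j)) (i := i) hi
    (fun k' hk' => by
      obtain rfl : k' = k := Fin.ext (by omega)
      have hkj : k' ≠ j := by
        rintro rfl
        have : (j : ℕ) = i + 1 := rfl
        omega
      rwa [Function.update_of_ne hkj, Function.update_of_ne hij])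
    (by
      rw [← hj, Function.update_self, Function.update_of_ne hij, hwi, hwj]
      have := mul_self_pos.mpr (hv i)
      linarith)
  rw [hasExactlySignChanges_iff_forall] at hx
  rw [hx _ hw2 hxw2, hx _ hw3 hxw3] at this
  exact lt_irrefl _ this

/-- A signature with exactly `n` sign changes has a completion in which each zero entry takes
the sign of its successor. -/
theorem exists_completion {x : Fin m → ℝ} (hx : HasExactlySignChanges x n) {l : Fin m}
    (hl : ∀ i, i ≤ l) (hxl : x l ≠ 0) :
    ∃ w : Fin m → ℝ, (∀ i, w i ≠ 0) ∧ (∀ i, x i ≠ 0 → w i = x i) ∧ #(signChangeSet w) = n ∧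
      (∀ i ∈ signChangeSet w, x i ≠ 0) ∧
      ∀ i, x i = 0 → ∃ k ∈ signChangeSet w, (k : ℕ) + 1 = i := by
  have hsucc : ∀ i, x i = 0 → (i : ℕ) + 1 < m := by
    intro i hi
    have h1 : i ≠ l := by rintro rfl; exact hxl hi
    have h2 : i < l := lt_of_le_of_ne (hl i) h1
    have := l.2
    have : (i : ℕ) < l := h2
    omega
  set w : Fin m → ℝ := fun i => if h : x i = 0 then x ⟨i + 1, hsucc i h⟩ else x i with hwdef
  have hw1 : ∀ i, x i ≠ 0 → w i = x i := fun i hi => by rw [hwdef]; simp [hi]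
  have hw0 : ∀ i (hi : x i = 0), w i = x ⟨i + 1, hsucc i hi⟩ := fun i hi => by
    rw [hwdef]; simp [hi]
  have hw : ∀ i, w i ≠ 0 := by
    intro i
    by_cases hi : x i = 0
    · rw [hw0 i hi]; exact succ_ne_zero_of_zero hx hi _
    · rwa [hw1 i hi]
  have hxw : ∀ i, 0 ≤ x i * w i := by
    intro i
    by_cases hi : x i = 0
    · simp [hi]
    · rw [hw1 i hi]; exact mul_self_nonneg _
  have hnext : ∀ i (hi : x i = 0), 0 < w i * w ⟨i + 1, hsucc i hi⟩ := by
    intro i hi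
    have h1 := succ_ne_zero_of_zero hx hi (hsucc i hi)
    rw [hw0 i hi, hw1 _ h1]
    exact mul_self_pos.mpr h1
  refine ⟨w, hw, hw1, (hasExactlySignChanges_iff_forall x n).mp hx w hw hxw, ?_, ?_⟩
  · intro i hi hxi
    obtain ⟨h, hlt⟩ := mem_signChangeSet.mp hi
    exact lt_asymm hlt (hnext i hxi)
  · intro i hxi
    obtain ⟨k, hk, hki⟩ := exists_prev_of_zero hx hw hxw hxi (hsucc i hxi) (hnext i hxi)
    have hkm : (k : ℕ) + 1 < m := by rw [hk]; exact i.2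
    have heq : (⟨k + 1, hkm⟩ : Fin m) = i := Fin.ext hk
    exact ⟨k, mem_signChangeSet.mpr ⟨hkm, by rwa [heq]⟩, hk⟩

/-! ### Realizing a signature -/

/-- The polynomial with prescribed signs: one root for every sign change, placed at a zero entry
of the signature or else between the two points. -/
theorem exists_polynomial_of_signs {lam : Fin m → ℝ} (hpos : ∀ i, 0 < lam i)
    (hlam : StrictAnti lam) {l : Fin m} (hl : ∀ i, i ≤ l) {x w : Fin m → ℝ}
    (hw : ∀ i, w i ≠ 0) (hxl : w l < 0)
    (hzero : ∀ i, x i = 0 → ∃ k ∈ signChangeSet w, (k : ℕ) + 1 = i) :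
    ∃ r : ℝ[X], r.degree < (#(signChangeSet w) + 1 : ℕ) ∧ r.eval 0 = 1 ∧
      (∀ i, x i = 0 → r.eval (lam i) = 0) ∧ ∀ i, x i ≠ 0 → r.eval (lam i) * w i < 0 := by
  -- The value of `theta` at the last index is immaterial, as it is never a sign change position.
  set theta : Fin m → ℝ := fun i =>
    if h : (i : ℕ) + 1 < m then
      if x ⟨i + 1, h⟩ = 0 then lam ⟨i + 1, h⟩ else gapMidpoint lam i
    else 0 with htheta
  have htheta' : ∀ (i : Fin m) (h : (i : ℕ) + 1 < m), theta i =
      if x ⟨i + 1, h⟩ = 0 then lam ⟨i + 1, h⟩ else gapMidpoint lam i := by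
    intro i h
    rw [htheta]; simp [h]
  have hlt : ∀ i ∈ signChangeSet w, theta i < lam i := by
    intro i hi
    obtain ⟨h, -⟩ := mem_signChangeSet.mp hi
    rw [htheta' i h]
    have := gapMidpoint_bounds hlam h
    split_ifs <;> linarith
  have hge : ∀ i ∈ signChangeSet w, ∀ h : (i : ℕ) + 1 < m, lam ⟨i + 1, h⟩ ≤ theta i := by
    intro i _ h
    rw [htheta' i h]
    have := gapMidpoint_bounds hlam h
    split_ifs <;> linarith
  have hgt : ∀ i ∈ signChangeSet w, ∀ j, x j ≠ 0 → i < j → lam j < theta i := by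
    intro i hi j hxj hij
    obtain ⟨h, -⟩ := mem_signChangeSet.mp hi
    have hle : (⟨i + 1, h⟩ : Fin m) ≤ j := hij
    rcases hle.eq_or_lt with rfl | hlt'
    · rw [htheta' i h, if_neg hxj]
      exact (gapMidpoint_bounds hlam h).1
    · exact (hlam hlt').trans_le (hge i hi h)
  have hthetapos : ∀ i ∈ signChangeSet w, 0 < theta i := by
    intro i hi
    obtain ⟨h, -⟩ := mem_signChangeSet.mp hi
    exact (hpos _).trans_le (hge i hi h)
  set c : ℝ := ∏ i ∈ signChangeSet w, theta i with hc
  have hcpos : 0 < c := prod_pos hthetapos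
  have heval : ∀ t, (C c⁻¹ * ∏ i ∈ signChangeSet w, (C (theta i) - X)).eval t =
      c⁻¹ * ∏ i ∈ signChangeSet w, (theta i - t) := by
    intro t
    simp [eval_prod]
  refine ⟨C c⁻¹ * ∏ i ∈ signChangeSet w, (C (theta i) - X), ?_, ?_, ?_, ?_⟩
  · rw [degree_C_mul (inv_ne_zero hcpos.ne'), degree_prod_C_sub_X]
    exact_mod_cast Nat.lt_succ_self _
  · rw [heval]
    simp only [sub_zero]
    exact inv_mul_cancel₀ hcpos.ne'
  · intro i hxi
    obtain ⟨k, hk, hki⟩ := hzero i hxi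
    have hkm : (k : ℕ) + 1 < m := by rw [hki]; exact i.2
    have heq : (⟨k + 1, hkm⟩ : Fin m) = i := Fin.ext hki
    rw [heval, prod_eq_zero hk, mul_zero]
    rw [htheta' k hkm, heq, if_pos hxi, sub_self]
  · intro i hxi
    have h1 := prod_sub_mul_pos hw hl lam theta i
      (fun k hk hik => (hlt k hk).trans_le (hlam.antitone hik))
      (fun k hk hki => hgt k hk i hxi hki)
    have h2 : 0 < c⁻¹ := inv_pos.mpr hcpos
    rw [heval]
    have h3 := mul_pos h2 h1
    refine neg_of_mul_pos_left (b := w l) ?_ hxl.le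
    linarith

/-- Weights which make a given polynomial a residual polynomial exist as soon as its values at
the sign change positions and at the last point alternate: they are supported there, and are given
by the coefficients of the divided difference of order `n`. -/
theorem exists_response {lam : Fin m → ℝ} (hlam : StrictAnti lam) {l : Fin m}
    (hl : ∀ i, i ≤ l) {w : Fin m → ℝ} (hw : ∀ i, w i ≠ 0) (hwl : w l < 0)
    (hn : #(signChangeSet w) = n) {r : ℝ[X]} (hdeg : r.degree < (n + 1 : ℕ))
    (hr0 : r.eval 0 = 1)
    (hr : ∀ i ∈ insert l (signChangeSet w), r.eval (lam i) * w i < 0) :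
    ∃ y : Fin m → ℝ, n < cardinality y ∧ IsResidual lam n y r := by
  set T := insert l (signChangeSet w) with hT
  set d : Fin m → ℝ := fun i => ∏ j ∈ T.erase i, (lam i - lam j) with hd
  have hTcard : #T = n + 1 := by rw [hT, card_insert_last w hl, hn]
  have hpos : ∀ i ∈ T, 0 < (-1) ^ n / (d i * r.eval (lam i)) := by
    intro i hi
    have h1 : 0 < d i * ((-1) ^ n * w i * w l) := by
      rw [← hn]; exact prod_erase_mul_pos hw hl hlam hi
    have h2 := hr i hi
    have h3 : 0 < (-1) ^ n * (d i * r.eval (lam i)) := by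
      have h4 : 0 < w i ^ 2 * (-w l) := mul_pos (by have := hw i; positivity) (by linarith)
      refine pos_of_mul_pos_left (b := w i ^ 2 * (-w l)) ?_ h4.le
      have := mul_pos h1 (neg_pos.mpr h2)
      linarith
    rw [div_eq_mul_inv]
    have h5 : d i * r.eval (lam i) ≠ 0 := right_ne_zero_of_mul h3.ne'
    have h6 : (-1) ^ n * (d i * r.eval (lam i))⁻¹ =
        ((-1) ^ n * (d i * r.eval (lam i))) / (d i * r.eval (lam i)) ^ 2 := by
      field_simp
    rw [h6]
    positivity
  set y : Fin m → ℝ := fun i =>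
    if i ∈ T then Real.sqrt ((-1) ^ n / (d i * r.eval (lam i))) else 0 with hy
  have hycard : cardinality y = n + 1 := by
    rw [cardinality_eq_card, ← hTcard]
    congr 1
    ext i
    simp only [mem_filter, mem_univ, true_and, hy]
    by_cases hi : i ∈ T
    · simp [hi, (Real.sqrt_pos.mpr (hpos i hi)).ne']
    · simp [hi]
  refine ⟨y, by omega, hdeg, hr0, fun k hk => ?_⟩
  have hXdeg : (X ^ k : ℝ[X]).degree < #T := by
    rw [degree_X_pow, hTcard]
    exact_mod_cast (by omega)
  have h1 := Lagrange.coeff_eq_sum hlam.injective.injOn hXdeg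
  rw [hTcard, Nat.add_sub_cancel, coeff_X_pow, if_neg hk.ne'] at h1
  rw [← sum_subset (subset_univ T), ← mul_zero ((-1 : ℝ) ^ n), h1, mul_sum]
  · refine sum_congr rfl fun i hi => ?_
    have h2 := hr i hi
    have h3 : r.eval (lam i) ≠ 0 := left_ne_zero_of_mul h2.ne
    have h4 : y i ^ 2 = (-1) ^ n / (d i * r.eval (lam i)) := by
      rw [hy]
      simp only [hi, if_true]
      exact Real.sq_sqrt (hpos i hi).le
    rw [h4, eval_pow, eval_X]
    change _ = (-1) ^ n * (lam i ^ k / d i)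
    rw [div_mul_eq_mul_div, div_mul_eq_mul_div, mul_comm (d i), mul_comm _ (eval _ _),
      mul_div_mul_left _ _ h3, mul_div_assoc]
  · intro i _ hi
    simp [hy, hi]

/-- Every signature with exactly `n` sign changes and last entry `-1` occurs. -/
theorem exists_shrinkagePattern_eq {lam : Fin m → ℝ} (hpos : ∀ i, 0 < lam i)
    (hlam : StrictAnti lam) {l : Fin m} (hl : ∀ i, i ≤ l) {s : Fin m → SignType}
    (hs : HasExactlySignChanges (fun i => ((s i : SignType) : ℝ)) n) (hsl : s l = -1) :
    ∃ y : Fin m → ℝ, n < cardinality y ∧ shrinkagePattern lam n y = s := by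
  obtain ⟨w, hw, hsw, hcard, hmem, hzero⟩ :=
    exists_completion hs hl (by simp [hsl])
  have hwl : w l < 0 := by rw [hsw l (by simp [hsl]), hsl]; simp
  obtain ⟨r, hdeg, hr0, hrzero, hrneg⟩ :=
    exists_polynomial_of_signs hpos hlam hl hw hwl hzero
  rw [hcard] at hdeg
  obtain ⟨y, hy, hres⟩ := exists_response hlam hl hw hwl hcard hdeg hr0 (by
    intro i hi
    refine hrneg i ?_
    rcases mem_insert.mp hi with rfl | hi
    · simp [hsl]
    · exact hmem i hi)
  refine ⟨y, hy, funext fun i => ?_⟩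
  rw [shrinkagePattern, hres.shrinkage_eq hpos hlam.injective hy.le, sub_sub_cancel_left]
  by_cases hi : ((s i : SignType) : ℝ) = 0
  · rw [hrzero i hi, neg_zero, sign_zero]
    cases h : s i <;> simp_all
  · have h1 := hrneg i hi
    rw [hsw i hi] at h1
    cases h : s i <;> simp [h] at h1 hi ⊢
    · exact sign_neg (neg_lt_zero.mpr h1)
    · exact sign_pos (neg_pos.mpr h1)

/-! ### Independence of the eigenvalues -/

theorem sign_one_sub_inv_mul {lam : Fin m → ℝ} (hpos : ∀ i, 0 < lam i)
    (hlam : StrictAnti lam) (i j : Fin m) :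
    SignType.sign (1 - (lam i)⁻¹ * lam j) = SignType.sign ((j : ℝ) - i) := by
  have hi := hpos i
  have h : 1 - (lam i)⁻¹ * lam j = (lam i)⁻¹ * (lam i - lam j) := by field_simp
  rw [h, sign_mul, sign_pos (inv_pos.mpr hi), one_mul]
  rcases lt_trichotomy i j with hij | rfl | hij
  · rw [sign_pos (sub_pos.mpr (hlam hij)), sign_pos (sub_pos.mpr (by exact_mod_cast hij))]
  · simp
  · rw [sign_neg (sub_neg.mpr (hlam hij)), sign_neg (sub_neg.mpr (by exact_mod_cast hij))]

/-- If `y` has only `n` nonzero entries, then the roots of the residual polynomial are the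
corresponding points, so that the signature depends on the support of `y` only. -/
theorem shrinkagePattern_of_cardinality_eq {lam : Fin m → ℝ} (hpos : ∀ i, 0 < lam i)
    (hlam : StrictAnti lam) {y : Fin m → ℝ} (hy : cardinality y = n) (j : Fin m) :
    shrinkagePattern lam n y j =
      SignType.sign (-1 : ℝ) * ∏ i with y i ≠ 0, SignType.sign ((j : ℝ) - i) := by
  have heval : ∀ t, (∏ i with y i ≠ 0, (1 - C (lam i)⁻¹ * X)).eval t =
      ∏ i with y i ≠ 0, (1 - (lam i)⁻¹ * t) := by
    intro t
    simp only [eval_prod, eval_sub, eval_one, eval_mul, eval_C, eval_X]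
  have hres : IsResidual lam n y (∏ i with y i ≠ 0, (1 - C (lam i)⁻¹ * X)) := by
    refine ⟨?_, ?_, fun k _ => sum_eq_zero fun i _ => ?_⟩
    · refine (degree_prod_le _ _).trans_lt ((sum_le_card_nsmul _ _ 1 fun i _ => ?_).trans_lt ?_)
      · refine (degree_sub_le _ _).trans (max_le ?_ (degree_C_mul_X_le _))
        exact degree_one_le.trans zero_le_one
      · rw [← cardinality_eq_card, hy, nsmul_one]
        exact_mod_cast Nat.lt_succ_self n
    · rw [heval]; simp
    · by_cases hi : y i = 0
      · simp [hi]
      · rw [heval, prod_eq_zero (i := i) (by simp [hi]), mul_zero]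
        rw [inv_mul_cancel₀ (hpos i).ne', sub_self]
  rw [shrinkagePattern, hres.shrinkage_eq hpos hlam.injective hy.ge, heval, sub_sub_cancel_left,
    ← neg_one_mul, sign_mul]
  congr 1
  exact (map_prod (signHom (α := ℝ)) _ _).trans (prod_congr rfl fun i _ =>
    sign_one_sub_inv_mul hpos hlam i j)

theorem hasExactlySignChanges_sign {x : Fin m → ℝ} (hx : HasExactlySignChanges x n) :
    HasExactlySignChanges (fun i => ((SignType.sign (x i) : SignType) : ℝ)) n := by
  rw [hasExactlySignChanges_iff_forall] at hx ⊢
  refine fun w hw hxw => hx w hw fun i => ?_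
  have h1 := mul_nonneg (abs_nonneg (x i)) (hxw i)
  rwa [← mul_assoc, abs_mul_sign] at h1

theorem possiblePatterns_subset {lam mu : Fin m → ℝ} (hpos : ∀ i, 0 < lam i)
    (hlam : StrictAnti lam) (hpos' : ∀ i, 0 < mu i) (hmu : StrictAnti mu) {l : Fin m}
    (hl : ∀ i, i ≤ l) : possiblePatterns lam n ⊆ possiblePatterns mu n := by
  rintro s ⟨y, hy, rfl⟩
  rcases hy.eq_or_lt with hy | hy
  · refine ⟨y, hy.le, funext fun j => ?_⟩
    rw [shrinkagePattern_of_cardinality_eq hpos hlam hy.symm,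
      shrinkagePattern_of_cardinality_eq hpos' hmu hy.symm]
  · obtain ⟨h1, h2⟩ := shrinkage_sub_one_signs hpos hlam hy hl
    obtain ⟨z, hz, hzs⟩ := exists_shrinkagePattern_eq hpos' hmu hl
      (s := shrinkagePattern lam n y) (hasExactlySignChanges_sign h2)
      (sign_neg (sub_neg.mpr h1))
    exact ⟨z, hz.le, hzs⟩

end PLS

theorem mainTheorem2 (m n : ℕ) (hnm : n < m) (lam : Fin m → ℝ)
    (hpos : ∀ i, 0 < lam i) (hlam : StrictAnti lam) :
    (∀ y : Fin m → ℝ, n < PLS.cardinality y →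
      PLS.shrinkage lam n y ⟨m - 1, by omega⟩ < 1 ∧
      PLS.HasExactlySignChanges (fun i => PLS.shrinkage lam n y i - 1) n) ∧
    (∀ s : Fin m → SignType,
      PLS.HasExactlySignChanges (fun i => ((s i : SignType) : ℝ)) n →
      s ⟨m - 1, by omega⟩ = -1 →
      ∃ y : Fin m → ℝ, n < PLS.cardinality y ∧ PLS.shrinkagePattern lam n y = s) ∧
    (∀ mu : Fin m → ℝ, (∀ i, 0 < mu i) → StrictAnti mu →
      PLS.possiblePatterns lam n = PLS.possiblePatterns mu n) := by
  have hl : ∀ i : Fin m, i ≤ ⟨m - 1, by omega⟩ := fun i => by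
    rw [Fin.le_def]
    have := i.2
    simp only
    omega
  exact ⟨fun y hy => PLS.shrinkage_sub_one_signs hpos hlam hy hl,
    fun s hs hsl => PLS.exists_shrinkagePattern_eq hpos hlam hl hs hsl,
    fun mu hmupos hmu => (PLS.possiblePatterns_subset hpos hlam hmupos hmu hl).antisymm
      (PLS.possiblePatterns_subset hmupos hmu hpos hlam hl)⟩
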